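/- Throughout, $\mathbb R^n$ ($n\ge 1$) carries its usual inner product and norm, $e_1,\dots,e_n$ is the standard basis, $B_\infty^n=[-1,1]^n$, $A^\circ=\{y\in\mathbb R^n:\langle x,y\rangle\le 1\ \text{for all }x\in A\}$ is the polar of $A$, and $d_{\mathcal H}$ is the Hausdorff distance. A symmetric convex body is a compact convex set $K$ with non-empty interior and $K=-K$. The $\ell_1$-sum of two convex sets $A,B$ is $\operatorname{conv}(A\cup B)$, and their $\ell_\infty$-sum is $A+B$. A standard Hanner polytope in $\mathbb R^n$ is a set obtained from the intervals $[-e_1,e_1],\dots,[-e_n,e_n]$, each used exactly once, by successively taking $\ell_1$- and $\ell_\infty$-sums. For $v\in\mathbb R^n$ put $$\mathbb R^{(v)}=\operatorname{span}\{e_j:\langle v,e_j\rangle\ne 0\},\qquad B_\infty^{(v)}=B_\infty^n\cap\mathbb R^{(v)},$$ and let $A|\mathbb R^{(v)}$ denote the orthogonal projection of $A$ to $\mathbb R^{(v)}$. **Proposition.** For every $n\ge 1$ there are constants $c=c(n)>0$ and $\delta_0=\delta_0(n)>0$ such that the following holds. Let $H$ be a standard Hanner polytope in $\mathbb R^n$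 and $K$ a symmetric convex body in $\mathbb R^n$ with $d_{\mathcal H}(K,H)=\delta$, where $0<\delta<\delta_0$. Then there exists either a vertex $v$ of $H$ with $$d_{\mathcal H}\bigl(K|\mathbb R^{(v)},\,B_\infty^{(v)}\bigr)\ge c\,\delta,$$ or a vertex $v^\star$ of $H^\circ$ with $$d_{\mathcal H}\bigl(K^\circ|\mathbb R^{(v^\star)},\,B_\infty^{(v^\star)}\bigr)\ge c\,\delta.$$ -/

import Mathlib

open scoped Pointwise

/-- `B` is a symmetric convex body: compact, convex, with non-empty interior, and `-B = B`. -/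
structure IsSymmConvexBody {n : ℕ} (B : Set (EuclideanSpace ℝ (Fin n))) : Prop where
  convex : Convex ℝ B
  isCompact : IsCompact B
  interior_nonempty : (interior B).Nonempty
  neg_eq : -B = B

/-- The polar `{y | ⟨x, y⟩ ≤ 1 for all x ∈ A}`. -/
def polarSet {n : ℕ} (A : Set (EuclideanSpace ℝ (Fin n))) : Set (EuclideanSpace ℝ (Fin n)) :=
  {y | ∀ x ∈ A, inner ℝ x y ≤ 1}

/-- The `ℓ₁`-sum of two convex sets. -/
def l1Sum {n : ℕ} (A B : Set (EuclideanSpace ℝ (Fin n))) : Set (EuclideanSpace ℝ (Fin n)) :=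
  convexHull ℝ (A ∪ B)

/-- The `ℓ_∞`-sum of two sets, i.e. their Minkowski sum. -/
def lInftySum {n : ℕ} (A B : Set (EuclideanSpace ℝ (Fin n))) : Set (EuclideanSpace ℝ (Fin n)) :=
  A + B

/-- `StdHannerOn S A`: the set `A` is obtained from the intervals `[-e_i, e_i]`, `i ∈ S`, each used
exactly once, by taking `ℓ₁`-sums and `ℓ_∞`-sums. -/
inductive StdHannerOn {n : ℕ} : Finset (Fin n) → Set (EuclideanSpace ℝ (Fin n)) → Prop
  | interval (i : Fin n) :
      StdHannerOn {i}
        (segment ℝ (-EuclideanSpace.single i (1 : ℝ)) (EuclideanSpace.single i (1 : ℝ)))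
  | l1 {S T : Finset (Fin n)} {A B : Set (EuclideanSpace ℝ (Fin n))} (hST : Disjoint S T)
      (hA : StdHannerOn S A) (hB : StdHannerOn T B) : StdHannerOn (S ∪ T) (l1Sum A B)
  | lInfty {S T : Finset (Fin n)} {A B : Set (EuclideanSpace ℝ (Fin n))} (hST : Disjoint S T)
      (hA : StdHannerOn S A) (hB : StdHannerOn T B) : StdHannerOn (S ∪ T) (lInftySum A B)

/-- `H` is a standard Hanner polytope in `ℝⁿ`. -/
def IsStandardHanner {n : ℕ} (H : Set (EuclideanSpace ℝ (Fin n))) : Prop :=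
  StdHannerOn Finset.univ H

/-- `v` is a vertex of `P`: a face of dimension zero, i.e. `{v}` is the intersection of `P` with
a supporting hyperplane (Mathlib calls such points exposed). -/
def IsVertex {n : ℕ} (P : Set (EuclideanSpace ℝ (Fin n))) (v : EuclideanSpace ℝ (Fin n)) : Prop :=
  v ∈ Set.exposedPoints ℝ P

/-- The subspace `ℝ^(v)` spanned by the `e_j` with `j` in the support of `v`. -/
def supportSpan {n : ℕ} (v : EuclideanSpace ℝ (Fin n)) :
    Submodule ℝ (EuclideanSpace ℝ (Fin n)) :=
  Submodule.span ℝ ((fun j : Fin n => EuclideanSpace.single j (1 : ℝ)) '' {j | v j ≠ 0})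

/-- The orthogonal projection `A | ℝ^(v)` of a set `A`, as a subset of `ℝⁿ`. -/
noncomputable def projSupport {n : ℕ} (A : Set (EuclideanSpace ℝ (Fin n)))
    (v : EuclideanSpace ℝ (Fin n)) : Set (EuclideanSpace ℝ (Fin n)) :=
  (supportSpan v).starProjection '' A

/-- The cube `B_∞ⁿ = [-1, 1]ⁿ`. -/
def unitCube (n : ℕ) : Set (EuclideanSpace ℝ (Fin n)) :=
  {x | ∀ i, |x i| ≤ 1}

/-- The lower dimensional cube `B_∞^(v) = B_∞ⁿ ∩ ℝ^(v)`. -/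
def supportCube {n : ℕ} (v : EuclideanSpace ℝ (Fin n)) : Set (EuclideanSpace ℝ (Fin n)) :=
  unitCube n ∩ (supportSpan v : Set (EuclideanSpace ℝ (Fin n)))

/-! A Hanner polytope is governed by two families of index sets: `H` is the convex hull of the sign
vectors on members of `𝓘`, and is cut out by `∑ j ∈ J, |x j| ≤ 1` for `J ∈ 𝓙`. Polarity exchanges
the families. Each `I ∈ 𝓘` meets each `J ∈ 𝓙` in one index, and any two indices share a member of
one of the families (`CrossCovering`, `StdHannerOn.exists_crossCovering`).

Suppose every projection in question is `ε`-close to its cube, with `ε = c δ`. Then each vertex `v`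
of `H` supported on `I` has a point `p ∈ K` that is `ε`-close to `v` on `I`, and each vertex `w` of
the polar has a similar `q` in the polar of `K`; both choices can be made odd. Off the supports only
`O(δ)` is known at first. If `v` and `w` agree at their common index, expanding `⟨p, q⟩ ≤ 1` gives
`⟨P, w⟩ + ⟨v, Q⟩ ≤ B` with `B = O(ε + δ²)`, where `P`, `Q` are the off-support parts.

This linear system is rigid (`abs_apply_le`): averaging over signs makes the bound two-sided, second
differences isolate single coordinates, and oddness turns small differences into small values. So
`P` and `Q` are `O(ε + δ²)`. Hence `K` contains points that close to the vertices of `H`, and nearly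
satisfies its facet inequalities, so `δ ≤ C (ε + δ²)` up to constants
(`hausdorffDist_le_of_projSupport`), which is false for small `c` and `δ`. -/

/-! ### Combinatorics of the supports of vertices and of polar vertices. -/

/-- Two families of subsets of `S`: any member of the first meets any member of the second in
exactly one point, and any two distinct points of `S` lie in a common member of one of them. -/
structure CrossCovering {ι : Type*} [DecidableEq ι] (S : Finset ι) (𝓘 𝓙 : Set (Finset ι)) :
    Prop where
  inter : ∀ I ∈ 𝓘, ∀ J ∈ 𝓙, ∃ i, I ∩ J = {i}
  pair : ∀ j ∈ S, ∀ k ∈ S, j ≠ k → (∃ I ∈ 𝓘, j ∈ I ∧ k ∈ I) ∨ ∃ J ∈ 𝓙, j ∈ J ∧ k ∈ J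
  cover_left : ∀ j ∈ S, ∃ I ∈ 𝓘, j ∈ I
  cover_right : ∀ j ∈ S, ∃ J ∈ 𝓙, j ∈ J
  subset_left : ∀ I ∈ 𝓘, I ⊆ S
  subset_right : ∀ J ∈ 𝓙, J ⊆ S
  nonempty_left : 𝓘.Nonempty
  nonempty_right : 𝓙.Nonempty

namespace CrossCovering

variable {ι : Type*} [DecidableEq ι] {S T : Finset ι} {𝓘 𝓙 𝓘' 𝓙' : Set (Finset ι)}

theorem symm (h : CrossCovering S 𝓘 𝓙) : CrossCovering S 𝓙 𝓘 where
  inter J hJ I hI := by simpa only [Finset.inter_comm] using h.inter I hI J hJ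
  pair j hj k hk hjk := (h.pair j hj k hk hjk).symm
  cover_left := h.cover_right
  cover_right := h.cover_left
  subset_left := h.subset_right
  subset_right := h.subset_left
  nonempty_left := h.nonempty_right
  nonempty_right := h.nonempty_left

theorem singleton (i : ι) : CrossCovering {i} {{i}} {{i}} where
  inter := by simp
  pair := by simp
  cover_left := by simp
  cover_right := by simp
  subset_left := by simp
  subset_right := by simp
  nonempty_left := by simp
  nonempty_right := by simp

/-- This is the effect of an `ℓ₁`-sum; the `ℓ_∞`-sum is the same with the families exchanged. A
member of the left family lies in one block, so it sees only one half of `J ∪ J'`. Indices from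
different blocks are joined by some `J ∪ J'`. -/
theorem union (h : CrossCovering S 𝓘 𝓙) (h' : CrossCovering T 𝓘' 𝓙') (hST : Disjoint S T) :
    CrossCovering (S ∪ T) (𝓘 ∪ 𝓘') (Set.image2 (· ∪ ·) 𝓙 𝓙') where
  inter := by
    rintro I hI _ ⟨J, hJ, J', hJ', rfl⟩
    have hd : ∀ {A B : Finset ι}, A ⊆ S → B ⊆ T → A ∩ B = ∅ := fun hA hB =>
      Finset.disjoint_iff_inter_eq_empty.1 (Finset.disjoint_of_subset_left hA
        (Finset.disjoint_of_subset_right hB hST))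
    rcases hI with hI | hI
    · obtain ⟨i, hi⟩ := h.inter I hI J hJ
      exact ⟨i, by simp only [Finset.inter_union_distrib_left, hi,
        hd (h.subset_left I hI) (h'.subset_right J' hJ'), Finset.union_empty]⟩
    · obtain ⟨i, hi⟩ := h'.inter I hI J' hJ'
      refine ⟨i, ?_⟩
      simp only [Finset.inter_union_distrib_left, hi]
      rw [Finset.inter_comm, hd (h.subset_right J hJ) (h'.subset_left I hI), Finset.empty_union]
  pair := by
    intro j hj k hk hjk
    rcases Finset.mem_union.1 hj with hj | hj <;> rcases Finset.mem_union.1 hk with hk | hk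
    · rcases h.pair j hj k hk hjk with ⟨I, hI, hh⟩ | ⟨J, hJ, hh⟩
      · exact Or.inl ⟨I, Or.inl hI, hh⟩
      · obtain ⟨J', hJ'⟩ := h'.nonempty_right
        exact Or.inr ⟨_, ⟨J, hJ, J', hJ', rfl⟩, by simp [hh.1], by simp [hh.2]⟩
    · obtain ⟨J, hJ, hjJ⟩ := h.cover_right j hj
      obtain ⟨J', hJ', hkJ⟩ := h'.cover_right k hk
      exact Or.inr ⟨_, ⟨J, hJ, J', hJ', rfl⟩, by simp [hjJ], by simp [hkJ]⟩
    · obtain ⟨J, hJ, hjJ⟩ := h.cover_right k hk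
      obtain ⟨J', hJ', hkJ⟩ := h'.cover_right j hj
      exact Or.inr ⟨_, ⟨J, hJ, J', hJ', rfl⟩, by simp [hkJ], by simp [hjJ]⟩
    · rcases h'.pair j hj k hk hjk with ⟨I, hI, hh⟩ | ⟨J', hJ', hh⟩
      · exact Or.inl ⟨I, Or.inr hI, hh⟩
      · obtain ⟨J, hJ⟩ := h.nonempty_right
        exact Or.inr ⟨_, ⟨J, hJ, J', hJ', rfl⟩, by simp [hh.1], by simp [hh.2]⟩
  cover_left := by
    intro j hj
    rcases Finset.mem_union.1 hj with hj | hj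
    · obtain ⟨I, hI, hh⟩ := h.cover_left j hj
      exact ⟨I, Or.inl hI, hh⟩
    · obtain ⟨I, hI, hh⟩ := h'.cover_left j hj
      exact ⟨I, Or.inr hI, hh⟩
  cover_right := by
    intro j hj
    obtain ⟨J, hJ⟩ := h.nonempty_right
    obtain ⟨J', hJ'⟩ := h'.nonempty_right
    rcases Finset.mem_union.1 hj with hj | hj
    · obtain ⟨J, hJ, hh⟩ := h.cover_right j hj
      exact ⟨_, ⟨J, hJ, J', hJ', rfl⟩, by simp [hh]⟩
    · obtain ⟨J', hJ', hh⟩ := h'.cover_right j hj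
      exact ⟨_, ⟨J, hJ, J', hJ', rfl⟩, by simp [hh]⟩
  subset_left := by
    rintro I (hI | hI)
    · exact (h.subset_left I hI).trans Finset.subset_union_left
    · exact (h'.subset_left I hI).trans Finset.subset_union_right
  subset_right := by
    rintro _ ⟨J, hJ, J', hJ', rfl⟩
    exact Finset.union_subset_union (h.subset_right J hJ) (h'.subset_right J' hJ')
  nonempty_left := h.nonempty_left.mono Set.subset_union_left
  nonempty_right := h.nonempty_right.image2 h'.nonempty_right

end CrossCovering

/-! ### Sign vectors, and the vertex and facet descriptions of Hanner polytopes. -/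

/-- `v` takes the values `±1` on `I` and vanishes elsewhere. -/
def IsSignVec {ι : Type*} (I : Finset ι) (v : ι → ℝ) : Prop :=
  ∀ i, (i ∈ I → |v i| = 1) ∧ (i ∉ I → v i = 0)

namespace IsSignVec

variable {ι : Type*} {I J : Finset ι} {v w : ι → ℝ}

theorem neg (h : IsSignVec I v) : IsSignVec I (-v) := fun i =>
  ⟨fun hi => by simpa using (h i).1 hi, fun hi => by simpa using (h i).2 hi⟩

theorem update [DecidableEq ι] (h : IsSignVec I v) {k : ι} {a : ℝ} (hk : k ∈ I) (ha : |a| = 1) :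
    IsSignVec I (Function.update v k a) := by
  intro i
  rcases eq_or_ne i k with rfl | hik
  · simp [hk, ha]
  · simpa [Function.update_of_ne hik] using h i

theorem abs_le_one (h : IsSignVec I v) (i : ι) : |v i| ≤ 1 := by
  by_cases hi : i ∈ I
  · exact ((h i).1 hi).le
  · simp [(h i).2 hi]

theorem mul_self (h : IsSignVec I v) {i : ι} (hi : i ∈ I) : v i * v i = 1 := by
  rw [← abs_mul_abs_self, (h i).1 hi, one_mul]

theorem ne_zero_iff (h : IsSignVec I v) {i : ι} : v i ≠ 0 ↔ i ∈ I := by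
  refine ⟨fun hv => by_contra fun hi => hv ((h i).2 hi), fun hi h0 => ?_⟩
  simpa [h0] using (h i).1 hi

theorem exists_sum_mul_eq_sum_abs [Fintype ι] [DecidableEq ι] (I : Finset ι) (x : ι → ℝ) :
    ∃ v, IsSignVec I v ∧ ∑ i, x i * v i = ∑ i ∈ I, |x i| := by
  refine ⟨fun i => if i ∈ I then (if 0 ≤ x i then 1 else -1) else 0, fun i => ⟨fun hi => ?_,
    fun hi => by simp [hi]⟩, ?_⟩
  · by_cases hx : 0 ≤ x i <;> simp [hi, hx]
  · rw [← Finset.sum_subset (Finset.subset_univ I) (fun i _ hi => by simp [hi])]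
    refine Finset.sum_congr rfl fun i hi => ?_
    by_cases hx : 0 ≤ x i
    · simp [hi, hx, abs_of_nonneg]
    · simp [hi, hx, abs_of_neg (not_le.1 hx)]

theorem sum_abs_eq_one [DecidableEq ι] (h : IsSignVec I v) {i : ι} (hIJ : I ∩ J = {i}) :
    ∑ j ∈ J, |v j| = 1 := by
  have hi : i ∈ I ∩ J := by simp [hIJ]
  rw [Finset.mem_inter] at hi
  rw [Finset.sum_eq_single_of_mem i hi.2, (h i).1 hi.1]
  intro j hj hji
  rw [(h j).2, abs_zero]
  intro hjI
  exact hji (Finset.mem_singleton.1 (hIJ ▸ Finset.mem_inter.2 ⟨hjI, hj⟩))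

end IsSignVec

/-- The points of Euclidean space that are sign vectors on a member of `𝓘`. -/
def signVecs {n : ℕ} (𝓘 : Set (Finset (Fin n))) : Set (EuclideanSpace ℝ (Fin n)) :=
  {v | ∃ I ∈ 𝓘, IsSignVec I v.ofLp}

theorem signVecs_union {n : ℕ} (𝓘 𝓘' : Set (Finset (Fin n))) :
    signVecs (𝓘 ∪ 𝓘') = signVecs 𝓘 ∪ signVecs 𝓘' := by
  ext v
  simp only [signVecs, Set.mem_union, Set.mem_ofPred_eq, or_and_right, exists_or]

theorem signVecs_image2_union {n : ℕ} {𝓘 𝓘' : Set (Finset (Fin n))} {S T : Finset (Fin n)}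
    (hS : ∀ I ∈ 𝓘, I ⊆ S) (hT : ∀ I ∈ 𝓘', I ⊆ T) (hST : Disjoint S T) :
    signVecs (Set.image2 (· ∪ ·) 𝓘 𝓘') = signVecs 𝓘 + signVecs 𝓘' := by
  ext v
  constructor
  · rintro ⟨_, ⟨I, hI, I', hI', rfl⟩, hv⟩
    have hd : ∀ i ∈ I', i ∉ I := fun i hi hi' =>
      Finset.disjoint_left.1 hST (hS I hI hi') (hT I' hI' hi)
    refine ⟨WithLp.toLp 2 fun i => if i ∈ I then v i else 0, ⟨I, hI, fun i => ?_⟩,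
      WithLp.toLp 2 fun i => if i ∈ I' then v i else 0, ⟨I', hI', fun i => ?_⟩, ?_⟩
    · exact ⟨fun hi => by simpa [hi] using (hv i).1 (by simp [hi]), fun hi => by simp [hi]⟩
    · exact ⟨fun hi => by simpa [hi] using (hv i).1 (by simp [hi]), fun hi => by simp [hi]⟩
    · ext i
      by_cases hi' : i ∈ I'
      · simp [hi', hd i hi']
      · by_cases hi : i ∈ I
        · simp [hi, hi']
        · simp [hi, hi', (hv i).2]
  · rintro ⟨a, ⟨I, hI, ha⟩, b, ⟨I', hI', hb⟩, rfl⟩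
    have hd : ∀ i ∈ I', i ∉ I := fun i hi hi' =>
      Finset.disjoint_left.1 hST (hS I hI hi') (hT I' hI' hi)
    refine ⟨_, ⟨I, hI, I', hI', rfl⟩, fun i => ?_⟩
    by_cases hi' : i ∈ I'
    · simp [hi', (ha i).2 (hd i hi'), (hb i).1 hi']
    · by_cases hi : i ∈ I
      · simp [hi, (ha i).1 hi, (hb i).2 hi']
      · simp [hi, hi', (ha i).2, (hb i).2]

theorem zero_mem_convexHull_signVecs {n : ℕ} {𝓘 : Set (Finset (Fin n))} (h : 𝓘.Nonempty) :
    (0 : EuclideanSpace ℝ (Fin n)) ∈ convexHull ℝ (signVecs 𝓘) := by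
  obtain ⟨I, hI⟩ := h
  obtain ⟨v, hv, -⟩ := IsSignVec.exists_sum_mul_eq_sum_abs I (0 : Fin n → ℝ)
  have h1 : WithLp.toLp 2 v ∈ convexHull ℝ (signVecs 𝓘) := subset_convexHull ℝ _ ⟨I, hI, hv⟩
  have h2 : WithLp.toLp 2 (-v) ∈ convexHull ℝ (signVecs 𝓘) :=
    subset_convexHull ℝ _ ⟨I, hI, hv.neg⟩
  have h3 := convex_convexHull ℝ (signVecs 𝓘) h1 h2 (a := 1 / 2) (b := 1 / 2)
    (by norm_num) (by norm_num) (by norm_num)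
  convert h3 using 1
  ext i
  simp

/-- Homogeneous form: a point `x` satisfying the inequalities with constant `t` lies in `t • A`. -/
theorem mem_smul_of_sum_abs_le {n : ℕ} {S : Finset (Fin n)} {A : Set (EuclideanSpace ℝ (Fin n))}
    {𝓙 : Set (Finset (Fin n))} (hcov : ∀ j ∈ S, ∃ J ∈ 𝓙, j ∈ J) (h0 : 0 ∈ A)
    (hA : ∀ x : EuclideanSpace ℝ (Fin n), (∀ i ∉ S, x i = 0) →
      (∀ J ∈ 𝓙, ∑ j ∈ J, |x j| ≤ 1) → x ∈ A)
    {x : EuclideanSpace ℝ (Fin n)} (hx : ∀ i ∉ S, x i = 0) {t : ℝ} (ht : 0 ≤ t)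
    (hxt : ∀ J ∈ 𝓙, ∑ j ∈ J, |x j| ≤ t) : x ∈ t • A := by
  rcases ht.eq_or_lt with rfl | ht
  · refine ⟨0, h0, ?_⟩
    ext j
    by_cases hj : j ∈ S
    · obtain ⟨J, hJ, hjJ⟩ := hcov j hj
      have := (Finset.single_le_sum (f := fun j => |x j|) (fun _ _ => abs_nonneg _) hjJ).trans
        (hxt J hJ)
      simpa using (abs_nonpos_iff.1 this).symm
    · simp [hx j hj]
  · refine ⟨t⁻¹ • x, hA _ (fun i hi => by simp [hx i hi]) (fun J hJ => ?_), ?_⟩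
    · simp only [PiLp.smul_apply, smul_eq_mul, abs_mul, ← Finset.mul_sum, abs_of_pos
        (inv_pos.2 ht)]
      rw [inv_mul_le_iff₀ ht, mul_one]
      exact hxt J hJ
    · simp [smul_smul, ht.ne']

/-- Only one inclusion of the facet description is carried through the induction; the other follows
from the one-point intersections, see `CrossCovering.mem_iff`. -/
theorem StdHannerOn.exists_crossCovering {n : ℕ} {S : Finset (Fin n)}
    {A : Set (EuclideanSpace ℝ (Fin n))} (h : StdHannerOn S A) :
    ∃ 𝓘 𝓙 : Set (Finset (Fin n)), CrossCovering S 𝓘 𝓙 ∧ A = convexHull ℝ (signVecs 𝓘) ∧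
      ∀ x : EuclideanSpace ℝ (Fin n), (∀ i ∉ S, x i = 0) →
        (∀ J ∈ 𝓙, ∑ j ∈ J, |x j| ≤ 1) → x ∈ A := by
  induction h with
  | interval i =>
    have hA : segment ℝ (-EuclideanSpace.single i (1 : ℝ)) (EuclideanSpace.single i (1 : ℝ)) =
        convexHull ℝ (signVecs {{i}}) := by
      rw [← convexHull_pair]
      congr 1
      ext v
      simp only [Set.mem_insert_iff, Set.mem_singleton_iff, signVecs, exists_eq_left,
        Set.mem_ofPred_eq]
      constructor
      · rintro (rfl | rfl) <;> intro j <;> by_cases hj : j = i <;> simp [hj]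
      · intro hv
        have h1 : ∀ j, j ≠ i → v j = 0 := fun j hj => (hv j).2 (by simpa using hj)
        rcases (abs_eq zero_le_one).1 ((hv i).1 (by simp)) with h2 | h2
        · right
          ext j
          rcases eq_or_ne j i with rfl | hj
          · simpa using h2
          · simp [hj, h1 j hj]
        · left
          ext j
          rcases eq_or_ne j i with rfl | hj
          · simpa using h2
          · simp [hj, h1 j hj]
    refine ⟨{{i}}, {{i}}, .singleton i, hA, fun x hx hxJ => ?_⟩
    have hxi : |x i| ≤ 1 := by simpa using hxJ {i} rfl
    obtain ⟨h1, h2⟩ := abs_le.1 hxi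
    refine ⟨(1 - x i) / 2, (1 + x i) / 2, by linarith, by linarith, by ring, ?_⟩
    ext j
    rcases eq_or_ne j i with rfl | hj
    · simp; ring
    · simp [hj, hx j (by simpa using hj)]
  | @l1 S T A B hST _ _ ihA ihB =>
    obtain ⟨𝓘, 𝓙, hc, hA, hA'⟩ := ihA
    obtain ⟨𝓘', 𝓙', hc', hB, hB'⟩ := ihB
    have hA0 : 0 ∈ A := hA ▸ zero_mem_convexHull_signVecs hc.nonempty_left
    have hB0 : 0 ∈ B := hB ▸ zero_mem_convexHull_signVecs hc'.nonempty_left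
    refine ⟨_, _, hc.union hc' hST, ?_, fun x hx hxJ => ?_⟩
    · rw [l1Sum, hA, hB, signVecs_union, convexHull_convexHull_union_left,
        convexHull_convexHull_union_right]
    -- The maxima `a` and `b` bound the gauges of the two block components of `x`. Since the union
    -- of the maximisers belongs to the new family, `a + b ≤ 1`, and `x` is a convex combination of
    -- `y`, `z` and `0`.
    · obtain ⟨J, hJ, hJmax⟩ := Set.exists_max_image 𝓙 (fun J => ∑ j ∈ J, |x j|)
        (Set.toFinite _) hc.nonempty_right
      obtain ⟨J', hJ', hJmax'⟩ := Set.exists_max_image 𝓙' (fun J => ∑ j ∈ J, |x j|)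
        (Set.toFinite _) hc'.nonempty_right
      set a := ∑ j ∈ J, |x j| with ha
      set b := ∑ j ∈ J', |x j| with hb
      have hab : a + b ≤ 1 := by
        rw [ha, hb, ← Finset.sum_union]
        · exact hxJ _ ⟨J, hJ, J', hJ', rfl⟩
        · exact Finset.disjoint_of_subset_left (hc.subset_right J hJ)
            (Finset.disjoint_of_subset_right (hc'.subset_right J' hJ') hST)
      have ha0 : 0 ≤ a := Finset.sum_nonneg fun _ _ => abs_nonneg _
      have hb0 : 0 ≤ b := Finset.sum_nonneg fun _ _ => abs_nonneg _
      have hxa : (WithLp.toLp 2 fun i => if i ∈ S then x i else 0 :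
          EuclideanSpace ℝ (Fin n)) ∈ a • A := by
        refine mem_smul_of_sum_abs_le hc.cover_right hA0 hA' (fun i hi => by simp [hi]) ha0
          fun L hL => ?_
        refine le_trans (le_of_eq (Finset.sum_congr rfl fun j hj => ?_)) (hJmax L hL)
        simp [hc.subset_right L hL hj]
      have hxb : (WithLp.toLp 2 fun i => if i ∈ T then x i else 0 :
          EuclideanSpace ℝ (Fin n)) ∈ b • B := by
        refine mem_smul_of_sum_abs_le hc'.cover_right hB0 hB' (fun i hi => by simp [hi]) hb0
          fun L hL => ?_
        refine le_trans (le_of_eq (Finset.sum_congr rfl fun j hj => ?_)) (hJmax' L hL)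
        simp [hc'.subset_right L hL hj]
      obtain ⟨y, hy, hya⟩ := hxa
      obtain ⟨z, hz, hzb⟩ := hxb
      have hconv : Convex ℝ (l1Sum A B) := convex_convexHull ℝ _
      have hy' : y ∈ l1Sum A B := subset_convexHull ℝ _ (Or.inl hy)
      have hz' : z ∈ l1Sum A B := subset_convexHull ℝ _ (Or.inr hz)
      have h0' : (0 : EuclideanSpace ℝ (Fin n)) ∈ l1Sum A B :=
        subset_convexHull ℝ _ (Or.inl hA0)
      have hxyz : x = a • y + b • z := by
        have e1 : a • y = _ := hya
        have e2 : b • z = _ := hzb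
        rw [e1, e2]
        ext i
        by_cases hi : i ∈ S
        · simp [hi, Finset.disjoint_left.1 hST hi]
        · by_cases hi' : i ∈ T
          · simp [hi, hi']
          · simp [hi, hi', hx i (by simp [hi, hi'])]
      have := hconv.sum_mem (t := Finset.univ) (w := ![a, b, 1 - a - b]) (z := ![y, z, 0])
        (by intro i _; fin_cases i <;> simp [ha0, hb0]; linarith)
        (by simp [Fin.sum_univ_three]) (by intro i _; fin_cases i <;> simpa)
      simpa [Fin.sum_univ_three, hxyz] using this
  | @lInfty S T A B hST _ _ ihA ihB =>
    obtain ⟨𝓘, 𝓙, hc, hA, hA'⟩ := ihA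
    obtain ⟨𝓘', 𝓙', hc', hB, hB'⟩ := ihB
    refine ⟨_, _, (hc.symm.union hc'.symm hST).symm, ?_, fun x hx hxJ => ?_⟩
    · rw [lInftySum, hA, hB, signVecs_image2_union hc.subset_left hc'.subset_left hST,
        convexHull_add]
    · refine ⟨WithLp.toLp 2 fun i => if i ∈ S then x i else 0,
        hA' _ (fun i hi => by simp [hi]) fun L hL => ?_,
        WithLp.toLp 2 fun i => if i ∈ T then x i else 0,
        hB' _ (fun i hi => by simp [hi]) fun L hL => ?_, ?_⟩
      · refine le_trans (le_of_eq (Finset.sum_congr rfl fun j hj => ?_)) (hxJ L (Or.inl hL))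
        simp [hc.subset_right L hL hj]
      · refine le_trans (le_of_eq (Finset.sum_congr rfl fun j hj => ?_)) (hxJ L (Or.inr hL))
        simp [hc'.subset_right L hL hj]
      · ext i
        by_cases hi : i ∈ S
        · simp [hi, Finset.disjoint_left.1 hST hi]
        · by_cases hi' : i ∈ T
          · simp [hi, hi']
          · simp [hi, hi', hx i (by simp [hi, hi'])]

/-! ### Rigidity of the linearised polarity inequalities. -/

theorem add_update_neg {ι : Type*} [DecidableEq ι] (v : ι → ℝ) (i : ι) :
    v + Function.update (-v) i (v i) = Pi.single i (2 * v i) := by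
  ext j
  rcases eq_or_ne j i with rfl | hj
  · simp; ring
  · simp [hj]

theorem sub_update_neg {ι : Type*} [DecidableEq ι] (v : ι → ℝ) (i : ι) :
    v - Function.update v i (-v i) = Pi.single i (2 * v i) := by
  ext j
  rcases eq_or_ne j i with rfl | hj
  · simp; ring
  · simp [hj]

section Rigidity

variable {ι : Type*} [Fintype ι] [DecidableEq ι]

theorem abs_le_three_mul_of_sum_eq_zero {a b c d B : ℝ} (ha : a ≤ B) (hb : b ≤ B) (hc : c ≤ B)
    (hd : d ≤ B) (h : a + b + c + d = 0) : |a| ≤ 3 * B :=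
  abs_le.2 ⟨by linarith, by linarith⟩

/-- `P I v` vanishes on `I` and is odd in `v`, for every sign vector `v` on a member `I` of `𝓘`. -/
structure IsOddOff (𝓘 : Set (Finset ι)) (P : Finset ι → (ι → ℝ) → ι → ℝ) : Prop where
  eq_zero : ∀ I ∈ 𝓘, ∀ v, IsSignVec I v → ∀ i ∈ I, P I v i = 0
  neg : ∀ I ∈ 𝓘, ∀ v, IsSignVec I v → P I (-v) = -P I v

variable {𝓘 𝓙 : Set (Finset ι)} {P Q : Finset ι → (ι → ℝ) → ι → ℝ} {B : ℝ}

/-- The upper bound becomes two-sided because the pairings of four sign choices sum to zero. -/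
theorem abs_pairing_le (hP : IsOddOff 𝓘 P) (hQ : IsOddOff 𝓙 Q)
    (hF : ∀ I ∈ 𝓘, ∀ J ∈ 𝓙, ∀ v w, IsSignVec I v → IsSignVec J w → ∀ i ∈ I, i ∈ J → v i = w i →
      P I v ⬝ᵥ w + v ⬝ᵥ Q J w ≤ B)
    {I J : Finset ι} (hI : I ∈ 𝓘) (hJ : J ∈ 𝓙) {v w : ι → ℝ} (hv : IsSignVec I v)
    (hw : IsSignVec J w) {i : ι} (hiI : i ∈ I) (hiJ : i ∈ J) :
    |P I v ⬝ᵥ w + v ⬝ᵥ Q J w| ≤ 3 * B := by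
  -- Flip all coordinates except the common index `i` in `v`, in `w`, or in both; the vectors still
  -- agree at `i`. In the sum of the four pairings, `v + v'` and `w + w'` are multiples of the
  -- `i`-th basis vector, and the off-support parts vanish at `i`.
  have key : ∀ w, IsSignVec J w → v i = w i → |P I v ⬝ᵥ w + v ⬝ᵥ Q J w| ≤ 3 * B := by
    intro w hw hvw
    have hv' := hv.neg.update hiI ((hv i).1 hiI)
    have hw' := hw.neg.update hiJ ((hw i).1 hiJ)
    refine abs_le_three_mul_of_sum_eq_zero (hF I hI J hJ v w hv hw i hiI hiJ hvw)
      (hF I hI J hJ v _ hv hw' i hiI hiJ (by simpa using hvw))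
      (hF I hI J hJ _ w hv' hw i hiI hiJ (by simpa using hvw))
      (hF I hI J hJ _ _ hv' hw' i hiI hiJ (by simpa using hvw)) ?_
    set v' := Function.update (-v) i (v i) with hv'_def
    set w' := Function.update (-w) i (w i) with hw'_def
    have e : P I v ⬝ᵥ w + v ⬝ᵥ Q J w + (P I v ⬝ᵥ w' + v ⬝ᵥ Q J w') +
        (P I v' ⬝ᵥ w + v' ⬝ᵥ Q J w) + (P I v' ⬝ᵥ w' + v' ⬝ᵥ Q J w') =
        (P I v + P I v') ⬝ᵥ (w + w') + (v + v') ⬝ᵥ (Q J w + Q J w') := by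
      simp only [add_dotProduct, dotProduct_add]
      ring
    rw [e, hv'_def, hw'_def, add_update_neg, add_update_neg, ← hv'_def, ← hw'_def,
      dotProduct_single, single_dotProduct]
    simp [hP.eq_zero I hI v hv i hiI, hP.eq_zero I hI v' hv' i hiI,
      hQ.eq_zero J hJ w hw i hiJ, hQ.eq_zero J hJ w' hw' i hiJ]
  -- If the signs at `i` are opposite, passing to `-w` merely negates the pairing, by oddness.
  rcases abs_eq_abs.1 (((hv i).1 hiI).trans ((hw i).1 hiJ).symm) with h | h
  · exact key w hw h
  · have := key (-w) hw.neg (by simpa using h)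
    rw [hQ.neg J hJ w hw, dotProduct_neg, dotProduct_neg, ← neg_add, abs_neg] at this
    exact this

/-- Second difference of the pairing under flipping `v k` and `w j`: only the coordinates `j` of `P`
and `k` of `Q` survive. Four pairings of size `3 * B` give `12 * B`, and the factor `2` from each
flip leaves `6 * B`. -/
theorem abs_mixed_difference_le (hP : IsOddOff 𝓘 P) (hQ : IsOddOff 𝓙 Q)
    (hF : ∀ I ∈ 𝓘, ∀ J ∈ 𝓙, ∀ v w, IsSignVec I v → IsSignVec J w → ∀ i ∈ I, i ∈ J → v i = w i →
      P I v ⬝ᵥ w + v ⬝ᵥ Q J w ≤ B)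
    {I J : Finset ι} (hI : I ∈ 𝓘) (hJ : J ∈ 𝓙) {v w : ι → ℝ} (hv : IsSignVec I v)
    (hw : IsSignVec J w) {i : ι} (hiI : i ∈ I) (hiJ : i ∈ J) {k j : ι} (hk : k ∈ I) (hj : j ∈ J) :
    |(P I v j - P I (Function.update v k (-v k)) j) * w j +
      v k * (Q J w k - Q J (Function.update w j (-w j)) k)| ≤ 6 * B := by
  have hv' := hv.update hk (a := -v k) (by simpa using (hv k).1 hk)
  have hw' := hw.update hj (a := -w j) (by simpa using (hw j).1 hj)
  have h1 := abs_le.1 (abs_pairing_le hP hQ hF hI hJ hv hw hiI hiJ)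
  have h2 := abs_le.1 (abs_pairing_le hP hQ hF hI hJ hv' hw hiI hiJ)
  have h3 := abs_le.1 (abs_pairing_le hP hQ hF hI hJ hv hw' hiI hiJ)
  have h4 := abs_le.1 (abs_pairing_le hP hQ hF hI hJ hv' hw' hiI hiJ)
  have hv_sub := sub_update_neg v k
  have hw_sub := sub_update_neg w j
  set v' := Function.update v k (-v k)
  set w' := Function.update w j (-w j)
  have e : P I v ⬝ᵥ w + v ⬝ᵥ Q J w - (P I v ⬝ᵥ w' + v ⬝ᵥ Q J w') -
      (P I v' ⬝ᵥ w + v' ⬝ᵥ Q J w) + (P I v' ⬝ᵥ w' + v' ⬝ᵥ Q J w') =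
      (P I v - P I v') ⬝ᵥ (w - w') + (v - v') ⬝ᵥ (Q J w - Q J w') := by
    simp only [sub_dotProduct, dotProduct_sub]
    ring
  rw [hv_sub, hw_sub, dotProduct_single, single_dotProduct, Pi.sub_apply, Pi.sub_apply] at e
  rw [abs_le]
  constructor <;> linarith [h1.1, h1.2, h2.1, h2.2, h3.1, h3.2, h4.1, h4.2]

/-- If `j` and `k` share some `J`, the `Q`-term of the mixed difference vanishes. If they share some
`I'`, comparing `J ∋ j` with `I'`, where the `P`-term vanishes, bounds the same `Q`-difference by `6
* B`, and a second comparison with `I` gives `12 * B`. -/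
theorem abs_sub_update_le (hc : CrossCovering Finset.univ 𝓘 𝓙)
    (hP : IsOddOff 𝓘 P) (hQ : IsOddOff 𝓙 Q)
    (hF : ∀ I ∈ 𝓘, ∀ J ∈ 𝓙, ∀ v w, IsSignVec I v → IsSignVec J w → ∀ i ∈ I, i ∈ J → v i = w i →
      P I v ⬝ᵥ w + v ⬝ᵥ Q J w ≤ B)
    {I : Finset ι} (hI : I ∈ 𝓘) {v : ι → ℝ} (hv : IsSignVec I v) {k j : ι} (hk : k ∈ I)
    (hj : j ∉ I) :
    |P I v j - P I (Function.update v k (-v k)) j| ≤ 12 * B := by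
  have meet : ∀ I ∈ 𝓘, ∀ J ∈ 𝓙, ∃ i, i ∈ I ∧ i ∈ J := fun I hI J hJ => by
    obtain ⟨i, hi⟩ := hc.inter I hI J hJ
    exact ⟨i, Finset.mem_inter.1 (hi ▸ Finset.mem_singleton_self i)⟩
  have sgn : ∀ J : Finset ι, ∃ w, IsSignVec J w := fun J =>
    (IsSignVec.exists_sum_mul_eq_sum_abs J 0).imp fun _ h => h.1
  have hv' := hv.update hk (a := -v k) (by simpa using (hv k).1 hk)
  have hB : 0 ≤ B := by
    obtain ⟨J, hJ⟩ := hc.nonempty_right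
    obtain ⟨i, hi, hi'⟩ := meet I hI J hJ
    obtain ⟨w, hw⟩ := sgn J
    linarith [(abs_nonneg _).trans (abs_pairing_le hP hQ hF hI hJ hv hw hi hi')]
  rcases hc.pair j (Finset.mem_univ _) k (Finset.mem_univ _) (fun h => hj (h ▸ hk)) with
    ⟨I', hI', hjI', hkI'⟩ | ⟨J, hJ, hjJ, hkJ⟩
  · obtain ⟨J, hJ, hjJ⟩ := hc.cover_right j (Finset.mem_univ _)
    obtain ⟨w, hw⟩ := sgn J
    have hw' := hw.update hjJ (a := -w j) (by simpa using (hw j).1 hjJ)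
    obtain ⟨i, hi, hi'⟩ := meet I hI J hJ
    obtain ⟨u, hu⟩ := sgn I'
    have hu' := hu.update hkI' (a := -u k) (by simpa using (hu k).1 hkI')
    have h1 := abs_mixed_difference_le hP hQ hF hI hJ hv hw hi hi' hk hjJ
    have h2 := abs_mixed_difference_le hP hQ hF hI' hJ hu hw hjI' hjJ hkI' hjJ
    rw [hP.eq_zero I' hI' u hu j hjI', hP.eq_zero I' hI' _ hu' j hjI', sub_zero, zero_mul,
      zero_add, abs_mul, (hu k).1 hkI', one_mul] at h2
    have h3 := abs_sub_abs_le_abs_add ((P I v j - P I (Function.update v k (-v k)) j) * w j)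
      (v k * (Q J w k - Q J (Function.update w j (-w j)) k))
    rw [abs_mul, abs_mul, (hw j).1 hjJ, (hv k).1 hk, mul_one, one_mul] at h3
    linarith
  · obtain ⟨w, hw⟩ := sgn J
    have hw' := hw.update hjJ (a := -w j) (by simpa using (hw j).1 hjJ)
    have h1 := abs_mixed_difference_le hP hQ hF hI hJ hv hw hk hkJ hk hjJ
    rw [hQ.eq_zero J hJ w hw k hkJ, hQ.eq_zero J hJ _ hw' k hkJ, sub_zero, mul_zero, add_zero,
      abs_mul, (hw j).1 hjJ, mul_one] at h1
    linarith

/-- Flipping the signs on `I` one at a time leads from `v` to `-v` at a cost of `12 * B` per flip,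
while oddness makes the total change `2 * P I v j`. -/
theorem abs_apply_le (hc : CrossCovering Finset.univ 𝓘 𝓙)
    (hP : IsOddOff 𝓘 P) (hQ : IsOddOff 𝓙 Q) (hB : 0 ≤ B)
    (hF : ∀ I ∈ 𝓘, ∀ J ∈ 𝓙, ∀ v w, IsSignVec I v → IsSignVec J w → ∀ i ∈ I, i ∈ J → v i = w i →
      P I v ⬝ᵥ w + v ⬝ᵥ Q J w ≤ B)
    {I : Finset ι} (hI : I ∈ 𝓘) {v : ι → ℝ} (hv : IsSignVec I v) (j : ι) :
    |P I v j| ≤ 6 * Fintype.card ι * B := by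
  by_cases hj : j ∈ I
  · rw [hP.eq_zero I hI v hv j hj, abs_zero]
    positivity
  have key : ∀ T : Finset ι, T ⊆ I → IsSignVec I (fun i => if i ∈ T then -v i else v i) ∧
      |P I v j - P I (fun i => if i ∈ T then -v i else v i) j| ≤ T.card * (12 * B) := by
    intro T
    induction T using Finset.induction_on with
    | empty => intro _; simpa using hv
    | insert k T hk ih =>
      intro hT
      obtain ⟨h1, h2⟩ := ih ((Finset.subset_insert k T).trans hT)
      have hkI := hT (Finset.mem_insert_self k T)
      have e : (fun i => if i ∈ insert k T then -v i else v i) =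
          Function.update (fun i => if i ∈ T then -v i else v i) k
            (-(fun i => if i ∈ T then -v i else v i) k) := by
        ext i
        rcases eq_or_ne i k with rfl | hik
        · simp [hk]
        · simp [hik]
      rw [e]
      refine ⟨h1.update hkI (by simpa using (h1 k).1 hkI), ?_⟩
      have h3 := abs_sub_update_le hc hP hQ hF hI h1 hkI hj
      rw [Finset.card_insert_of_notMem hk]
      push_cast
      refine (abs_sub_le _ (P I (fun i => if i ∈ T then -v i else v i) j) _).trans ?_
      linarith
  have h := (key I subset_rfl).2
  have e : (fun i => if i ∈ I then -v i else v i) = -v := by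
    ext i
    by_cases hi : i ∈ I
    · simp [hi]
    · simp [hi, (hv i).2 hi]
  rw [e, hP.neg I hI v hv, Pi.neg_apply, sub_neg_eq_add, ← two_mul, abs_mul, abs_two] at h
  have hcard : (I.card : ℝ) ≤ Fintype.card ι := by exact_mod_cast Finset.card_le_univ I
  nlinarith

end Rigidity

/-! ### From the polarity inequality to its linearisation. -/

/-- Off-support parts of nearly polar families are small to first order. -/
theorem abs_apply_le_of_pairing_le_one {ι : Type*} [Fintype ι] [DecidableEq ι]
    {𝓘 𝓙 : Set (Finset ι)} (hc : CrossCovering Finset.univ 𝓘 𝓙)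
    {p q : Finset ι → (ι → ℝ) → ι → ℝ} {ε D : ℝ} (hε : 0 ≤ ε) (hε1 : ε ≤ 1) (hD : 0 ≤ D)
    (hD1 : D ≤ 1)
    (hp_neg : ∀ I ∈ 𝓘, ∀ v, IsSignVec I v → p I (-v) = -p I v)
    (hp_mem : ∀ I ∈ 𝓘, ∀ v, IsSignVec I v → ∀ i ∈ I, |p I v i - v i| ≤ ε)
    (hp_notMem : ∀ I ∈ 𝓘, ∀ v, IsSignVec I v → ∀ i ∉ I, |p I v i| ≤ D)
    (hq_neg : ∀ J ∈ 𝓙, ∀ w, IsSignVec J w → q J (-w) = -q J w)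
    (hq_mem : ∀ J ∈ 𝓙, ∀ w, IsSignVec J w → ∀ j ∈ J, |q J w j - w j| ≤ ε)
    (hq_notMem : ∀ J ∈ 𝓙, ∀ w, IsSignVec J w → ∀ j ∉ J, |q J w j| ≤ D)
    (hpq : ∀ I ∈ 𝓘, ∀ J ∈ 𝓙, ∀ v w, IsSignVec I v → IsSignVec J w → p I v ⬝ᵥ q J w ≤ 1)
    {I : Finset ι} (hI : I ∈ 𝓘) {v : ι → ℝ} (hv : IsSignVec I v) {j : ι} (hj : j ∉ I) :
    |p I v j| ≤ 18 * Fintype.card ι ^ 2 * (ε + D ^ 2) := by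
  set P : Finset ι → (ι → ℝ) → ι → ℝ := fun I v i => if i ∈ I then 0 else p I v i with hP
  set Q : Finset ι → (ι → ℝ) → ι → ℝ := fun J w i => if i ∈ J then 0 else q J w i with hQ
  have hPodd : IsOddOff 𝓘 P := ⟨fun I _ v _ i hi => by simp [hP, hi], fun I hI v hv => by
    ext i
    by_cases hi : i ∈ I <;> simp [hP, hi, hp_neg I hI v hv]⟩
  have hQodd : IsOddOff 𝓙 Q := ⟨fun I _ v _ i hi => by simp [hQ, hi], fun I hI v hv => by
    ext i
    by_cases hi : i ∈ I <;> simp [hQ, hi, hq_neg I hI v hv]⟩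
  have key := abs_apply_le (B := 3 * Fintype.card ι * (ε + D ^ 2)) hc hPodd hQodd (by positivity)
    (fun I hI J hJ v w hv hw i hiI hiJ hvw => ?_) hI hv j
  · simp only [hP, hj, if_false] at key
    linarith
  -- Coordinatewise expansion of `p I v ⬝ᵥ q J w`; the `Pi.single` term records the main term `v i *
  -- w i = 1`. The error is at most `3 * ε` at the common index, `ε` on exactly one support, and `D
  -- ^ 2` off both.
  · have hterm : ∀ m, P I v m * w m + v m * Q J w m + (Pi.single i 1 : ι → ℝ) m ≤
        p I v m * q J w m + 3 * (ε + D ^ 2) := by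
      intro m
      have hD2 : 0 ≤ D ^ 2 := by positivity
      by_cases hmI : m ∈ I <;> by_cases hmJ : m ∈ J
      · have hmi : m = i := by
          obtain ⟨i', hi'⟩ := hc.inter I hI J hJ
          have h1 : m ∈ I ∩ J := Finset.mem_inter.2 ⟨hmI, hmJ⟩
          have h2 : i ∈ I ∩ J := Finset.mem_inter.2 ⟨hiI, hiJ⟩
          rw [hi', Finset.mem_singleton] at h1 h2
          rw [h1, h2]
        subst hmi
        have h1 := hp_mem I hI v hv m hmI
        have h2 := hq_mem J hJ w hw m hmJ
        rw [← hvw] at h2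
        have h3 := hv.mul_self hmI
        have e : p I v m * q J w m = (p I v m - v m) * (q J w m - v m) +
          (p I v m - v m) * v m + (q J w m - v m) * v m + v m * v m := by ring
        have hb : ∀ {a b : ℝ}, |a| ≤ ε → |b| ≤ 1 → -ε ≤ a * b := fun {a b} ha hb => by
          refine (abs_le.1 ?_).1
          rw [abs_mul]
          exact (mul_le_mul ha hb (abs_nonneg _) hε).trans (mul_one ε).le
        have h4 := hb h1 (h2.trans hε1)
        have h5 := hb h1 (hv.abs_le_one m)
        have h6 := hb h2 (hv.abs_le_one m)
        simp only [hP, hQ, hmI, hmJ, if_true, Pi.single_eq_same]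
        linarith
      · have hmi : m ≠ i := fun h => hmJ (h ▸ hiJ)
        have h1 := hp_mem I hI v hv m hmI
        have h2 := hq_notMem J hJ w hw m hmJ
        have h3 : |(p I v m - v m) * q J w m| ≤ ε * 1 := by
          rw [abs_mul]
          exact mul_le_mul h1 (h2.trans hD1) (abs_nonneg _) hε
        have h4 := (abs_le.1 h3).1
        simp only [hP, hQ, hmI, hmJ, if_true, if_false, Pi.single_eq_of_ne hmi]
        linarith
      · have hmi : m ≠ i := fun h => hmI (h ▸ hiI)
        have h1 := hp_notMem I hI v hv m hmI
        have h2 := hq_mem J hJ w hw m hmJ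
        have h3 : |p I v m * (q J w m - w m)| ≤ 1 * ε := by
          rw [abs_mul]
          exact mul_le_mul (h1.trans hD1) h2 (abs_nonneg _) zero_le_one
        have h4 := (abs_le.1 h3).1
        simp only [hP, hQ, hmI, hmJ, if_true, if_false, Pi.single_eq_of_ne hmi]
        linarith
      · have hmi : m ≠ i := fun h => hmI (h ▸ hiI)
        have h1 := hp_notMem I hI v hv m hmI
        have h2 := hq_notMem J hJ w hw m hmJ
        have h3 : |p I v m * q J w m| ≤ D * D := by
          rw [abs_mul]
          exact mul_le_mul h1 h2 (abs_nonneg _) hD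
        have h4 := (abs_le.1 h3).1
        simp only [hP, hQ, hmI, hmJ, if_false, Pi.single_eq_of_ne hmi, (hv m).2 hmI,
          (hw m).2 hmJ]
        nlinarith
    have hsum := Finset.sum_le_sum fun m (_ : m ∈ Finset.univ) => hterm m
    simp only [Finset.sum_add_distrib, Finset.sum_pi_single', Finset.sum_const,
      Finset.card_univ, nsmul_eq_mul, Finset.mem_univ, if_true] at hsum
    have h1 := hpq I hI J hJ v w hv hw
    simp only [dotProduct] at h1 ⊢
    have h2 : ∑ m, (Pi.single i 1 : ι → ℝ) m = 1 := by simp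
    linarith

/-! ### Coordinates, projections and polars in Euclidean space. -/

section Euclidean

variable {n : ℕ}

theorem EuclideanSpace.inner_eq_sum_mul (x y : EuclideanSpace ℝ (Fin n)) :
    inner ℝ x y = ∑ i, x i * y i := by
  simp [PiLp.inner_apply, mul_comm]

theorem EuclideanSpace.norm_le_sum_abs (x : EuclideanSpace ℝ (Fin n)) : ‖x‖ ≤ ∑ i, |x i| := by
  have h : x = ∑ i, x i • EuclideanSpace.single i (1 : ℝ) := by
    ext j
    simp [Finset.sum_apply, Pi.single_apply]
  calc ‖x‖ = ‖∑ i, x i • EuclideanSpace.single i (1 : ℝ)‖ := by rw [← h]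
    _ ≤ ∑ i, ‖x i • EuclideanSpace.single i (1 : ℝ)‖ := norm_sum_le _ _
    _ = ∑ i, |x i| := by simp [norm_smul]

theorem EuclideanSpace.norm_le_mul_of_abs_le {x : EuclideanSpace ℝ (Fin n)} {r : ℝ}
    (h : ∀ i, |x i| ≤ r) : ‖x‖ ≤ n * r := by
  refine (EuclideanSpace.norm_le_sum_abs x).trans ((Finset.sum_le_sum fun i _ => h i).trans ?_)
  simp

theorem single_mem_supportSpan {v : EuclideanSpace ℝ (Fin n)} {i : Fin n} (hi : v i ≠ 0) :
    EuclideanSpace.single i (1 : ℝ) ∈ supportSpan v :=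
  Submodule.subset_span ⟨i, hi, rfl⟩

theorem self_mem_supportSpan (v : EuclideanSpace ℝ (Fin n)) : v ∈ supportSpan v := by
  have h : v = ∑ i, v i • EuclideanSpace.single i (1 : ℝ) := by
    ext j
    simp [Finset.sum_apply, Pi.single_apply]
  nth_rewrite 2 [h]
  refine Submodule.sum_mem _ fun i _ => ?_
  by_cases hi : v i = 0
  · simp [hi]
  · exact Submodule.smul_mem _ _ (single_mem_supportSpan hi)

theorem starProjection_supportSpan_apply (v x : EuclideanSpace ℝ (Fin n)) {i : Fin n}
    (hi : v i ≠ 0) : (supportSpan v).starProjection x i = x i := by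
  have h1 := Submodule.inner_starProjection_left_eq_right (supportSpan v)
    (EuclideanSpace.single i (1 : ℝ)) x
  rw [Submodule.starProjection_eq_self_iff.2 (single_mem_supportSpan hi)] at h1
  simpa [EuclideanSpace.inner_single_left] using h1.symm

theorem isBounded_supportCube (v : EuclideanSpace ℝ (Fin n)) :
    Bornology.IsBounded (supportCube v) :=
  (Metric.isBounded_closedBall (x := 0) (r := n * 1)).subset fun x hx => by
    simpa using EuclideanSpace.norm_le_mul_of_abs_le hx.1

theorem exists_near_of_hausdorffDist_lt {A : Set (EuclideanSpace ℝ (Fin n))}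
    (hA : Bornology.IsBounded A) (hA' : A.Nonempty) {I : Finset (Fin n)}
    {v : EuclideanSpace ℝ (Fin n)} (hv : IsSignVec I v.ofLp) {ε : ℝ}
    (h : Metric.hausdorffDist (projSupport A v) (supportCube v) < ε) :
    ∃ p ∈ A, ∀ i ∈ I, |p i - v i| ≤ ε := by
  have hv' : v ∈ supportCube v := ⟨hv.abs_le_one, self_mem_supportSpan v⟩
  have hb : Bornology.IsBounded (projSupport A v) := by
    obtain ⟨R, hR⟩ := hA.subset_closedBall 0
    refine (((isCompact_closedBall (0 : EuclideanSpace ℝ (Fin n)) R).image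
      (supportSpan v).starProjection.continuous).isBounded).subset (Set.image_mono hR)
  have hfin := Metric.hausdorffEDist_ne_top_of_nonempty_of_bounded (hA'.image _) ⟨v, hv'⟩ hb
    (isBounded_supportCube v)
  obtain ⟨_, ⟨p, hp, rfl⟩, hpv⟩ := Metric.exists_dist_lt_of_hausdorffDist_lt' hv' h hfin
  refine ⟨p, hp, fun i hi => ?_⟩
  rw [dist_eq_norm] at hpv
  have := (PiLp.norm_apply_le ((supportSpan v).starProjection p - v) i).trans hpv.le
  rw [PiLp.sub_apply, starProjection_supportSpan_apply v p (hv.ne_zero_iff.2 hi)] at this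
  exact this

theorem polarSet_neg_mem {A : Set (EuclideanSpace ℝ (Fin n))} (hA : -A = A)
    {y : EuclideanSpace ℝ (Fin n)} (hy : y ∈ polarSet A) : -y ∈ polarSet A := fun x hx => by
  have := hy (-x) (by rw [← hA]; simpa using hx)
  simpa using this

theorem convex_polarSet (A : Set (EuclideanSpace ℝ (Fin n))) : Convex ℝ (polarSet A) := by
  intro y hy z hz a b ha hb hab x hx
  rw [inner_add_right, inner_smul_right, inner_smul_right]
  nlinarith [hy x hx, hz x hx]

theorem zero_mem_polarSet (A : Set (EuclideanSpace ℝ (Fin n))) : 0 ∈ polarSet A := fun x _ => by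
  simp

end Euclidean

/-! ### Vertices, polar description and selection of nearby points. -/

section Polytope

variable {n : ℕ} {𝓘 𝓙 : Set (Finset (Fin n))} {A : Set (EuclideanSpace ℝ (Fin n))}

/-- The functional `⟨v, ·⟩` exposes `v`: a maximiser `y` equals `v` on `I`, and for `j ∉ I` some `J
∋ j` contains an `i ∈ I` with `|y i| = 1`, which leaves nothing for `y j`. -/
theorem CrossCovering.isVertex (hc : CrossCovering Finset.univ 𝓘 𝓙)
    (hA : ∀ x, x ∈ A ↔ ∀ J ∈ 𝓙, ∑ j ∈ J, |x j| ≤ 1) {I : Finset (Fin n)} (hI : I ∈ 𝓘)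
    {v : EuclideanSpace ℝ (Fin n)} (hv : IsSignVec I v.ofLp) : IsVertex A v := by
  have hle : ∀ y ∈ A, ∀ i, |y i| ≤ 1 := fun y hy i => by
    obtain ⟨J, hJ, hiJ⟩ := hc.cover_right i (Finset.mem_univ i)
    exact (Finset.single_le_sum (f := fun j => |y j|) (fun _ _ => abs_nonneg _) hiJ).trans
      ((hA y).1 hy J hJ)
  have hterm : ∀ y ∈ A, ∀ i, v i * y i ≤ v i * v i := fun y hy i => by
    by_cases hi : i ∈ I
    · rw [hv.mul_self hi]
      refine (le_abs_self _).trans ?_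
      rw [abs_mul, (hv i).1 hi, one_mul]
      exact hle y hy i
    · simp [(hv i).2 hi]
  refine ⟨(hA v).2 fun J hJ => ?_, innerSL ℝ v, fun y hy => ⟨?_, fun h => ?_⟩⟩
  · obtain ⟨i, hi⟩ := hc.inter I hI J hJ
    exact (hv.sum_abs_eq_one hi).le
  · simp only [innerSL_apply_apply, EuclideanSpace.inner_eq_sum_mul]
    exact Finset.sum_le_sum fun i _ => hterm y hy i
  · simp only [innerSL_apply_apply, EuclideanSpace.inner_eq_sum_mul] at h
    have heq := (Finset.sum_eq_sum_iff_of_le fun i _ => hterm y hy i).1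
      (le_antisymm (Finset.sum_le_sum fun i _ => hterm y hy i) h)
    have hI_eq : ∀ i ∈ I, y i = v i := fun i hi =>
      mul_left_cancel₀ (hv.ne_zero_iff.2 hi) (heq i (Finset.mem_univ i))
    ext j
    by_cases hj : j ∈ I
    · exact hI_eq j hj
    · obtain ⟨J, hJ, hjJ⟩ := hc.cover_right j (Finset.mem_univ j)
      obtain ⟨i, hi⟩ := hc.inter I hI J hJ
      obtain ⟨hiI, hiJ⟩ := Finset.mem_inter.1 (hi ▸ Finset.mem_singleton_self i)
      have h1 := Finset.add_le_sum (f := fun j => |y j|) (fun _ _ => abs_nonneg _) hiJ hjJ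
        (fun h => hj (h ▸ hiI))
      have h2 := h1.trans ((hA y).1 hy J hJ)
      simp only [hI_eq i hiI, (hv i).1 hiI] at h2
      have h3 : y j = 0 := abs_nonpos_iff.1 (by linarith)
      rw [h3, (hv j).2 hj]

theorem CrossCovering.mem_iff (hc : CrossCovering Finset.univ 𝓘 𝓙)
    (hA : A = convexHull ℝ (signVecs 𝓘))
    (hA' : ∀ x : EuclideanSpace ℝ (Fin n), (∀ J ∈ 𝓙, ∑ j ∈ J, |x j| ≤ 1) → x ∈ A)
    (x : EuclideanSpace ℝ (Fin n)) : x ∈ A ↔ ∀ J ∈ 𝓙, ∑ j ∈ J, |x j| ≤ 1 := by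
  refine ⟨fun hx J hJ => ?_, hA' x⟩
  have hconv : Convex ℝ {x : EuclideanSpace ℝ (Fin n) | ∑ j ∈ J, |x j| ≤ 1} := by
    intro y hy z hz a b ha hb hab
    calc ∑ j ∈ J, |(a • y + b • z) j| ≤ ∑ j ∈ J, (a * |y j| + b * |z j|) := by
          refine Finset.sum_le_sum fun j _ => (abs_add_le _ _).trans ?_
          simp [abs_mul, abs_of_nonneg ha, abs_of_nonneg hb]
      _ = a * ∑ j ∈ J, |y j| + b * ∑ j ∈ J, |z j| := by
          rw [Finset.sum_add_distrib, Finset.mul_sum, Finset.mul_sum]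
      _ ≤ a * 1 + b * 1 := add_le_add (mul_le_mul_of_nonneg_left hy ha)
          (mul_le_mul_of_nonneg_left hz hb)
      _ = 1 := by linarith
  refine convexHull_min (s := signVecs 𝓘) ?_ hconv (hA ▸ hx)
  rintro v ⟨I, hI, hv⟩
  obtain ⟨i, hi⟩ := hc.inter I hI J hJ
  exact (hv.sum_abs_eq_one hi).le

/-- This gives the polar the facet form of `H` with the families exchanged, so that results proved
for `H` apply to it through `CrossCovering.symm`. -/
theorem mem_polarSet_convexHull_signVecs_iff (y : EuclideanSpace ℝ (Fin n)) :
    y ∈ polarSet (convexHull ℝ (signVecs 𝓘)) ↔ ∀ I ∈ 𝓘, ∑ i ∈ I, |y i| ≤ 1 := by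
  constructor
  · intro hy I hI
    obtain ⟨v, hv, hsum⟩ := IsSignVec.exists_sum_mul_eq_sum_abs I y.ofLp
    have := hy (WithLp.toLp 2 v) (subset_convexHull ℝ _ ⟨I, hI, hv⟩)
    rw [real_inner_comm, EuclideanSpace.inner_eq_sum_mul] at this
    linarith
  · intro hy x hx
    have hconv : Convex ℝ {x : EuclideanSpace ℝ (Fin n) | inner ℝ x y ≤ 1} := by
      intro z hz w hw a b ha hb hab
      change inner ℝ (a • z + b • w) y ≤ 1
      rw [inner_add_left, real_inner_smul_left, real_inner_smul_left]
      have h1 : inner ℝ z y ≤ 1 := hz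
      have h2 : inner ℝ w y ≤ 1 := hw
      nlinarith
    refine convexHull_min (s := signVecs 𝓘) ?_ hconv hx
    rintro v ⟨I, hI, hv⟩
    refine le_trans ?_ (hy I hI)
    change inner ℝ v y ≤ _
    rw [EuclideanSpace.inner_eq_sum_mul,
      ← Finset.sum_subset (Finset.subset_univ I) (fun i _ hi => by simp [(hv i).2 hi])]
    refine Finset.sum_le_sum fun i hi => (le_abs_self _).trans ?_
    rw [abs_mul, (hv i).1 hi, one_mul]

/-- An odd choice of points of `A` lying near the sign vectors on members of `𝓘`. -/
theorem CrossCovering.exists_odd_selection (hc : CrossCovering Finset.univ 𝓘 𝓙)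
    (hA : Convex ℝ A) (hA' : ∀ x ∈ A, -x ∈ A) {ε t : ℝ}
    (hle : ∀ x ∈ A, ∀ J ∈ 𝓙, ∑ j ∈ J, |x j| ≤ 1 + t)
    (hnear : ∀ I ∈ 𝓘, ∀ v : EuclideanSpace ℝ (Fin n), IsSignVec I v.ofLp →
      ∃ p ∈ A, ∀ i ∈ I, |p i - v i| ≤ ε) :
    ∃ p : Finset (Fin n) → (Fin n → ℝ) → Fin n → ℝ,
      (∀ I ∈ 𝓘, ∀ v, IsSignVec I v → p I (-v) = -p I v) ∧
      (∀ I ∈ 𝓘, ∀ v, IsSignVec I v → ∀ i ∈ I, |p I v i - v i| ≤ ε) ∧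
      (∀ I ∈ 𝓘, ∀ v, IsSignVec I v → ∀ i ∉ I, |p I v i| ≤ t + ε) ∧
      (∀ I ∈ 𝓘, ∀ v, IsSignVec I v → WithLp.toLp 2 (p I v) ∈ A) := by
  have hnear' : ∀ (I : Finset (Fin n)) (v : Fin n → ℝ), ∃ p : EuclideanSpace ℝ (Fin n),
      I ∈ 𝓘 → IsSignVec I v → p ∈ A ∧ ∀ i ∈ I, |p i - v i| ≤ ε := fun I v => by
    by_cases h : I ∈ 𝓘 ∧ IsSignVec I v
    · obtain ⟨p, hp⟩ := hnear I h.1 (WithLp.toLp 2 v) h.2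
      exact ⟨p, fun _ _ => hp⟩
    · exact ⟨0, fun h1 h2 => absurd ⟨h1, h2⟩ h⟩
  choose f hf using hnear'
  have hmem : ∀ I ∈ 𝓘, ∀ v, IsSignVec I v → ∀ i ∈ I,
      |((f I v).ofLp - (f I (-v)).ofLp) i / 2 - v i| ≤ ε := fun I hI v hv i hi => by
    have h1 := abs_le.1 ((hf I v hI hv).2 i hi)
    have h2 := abs_le.1 ((hf I (-v) hI hv.neg).2 i hi)
    simp only [Pi.neg_apply, Pi.sub_apply] at h1 h2 ⊢
    rw [abs_le]
    constructor <;> linarith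
  have hA2 : ∀ I ∈ 𝓘, ∀ v, IsSignVec I v →
      WithLp.toLp 2 (fun i => ((f I v).ofLp - (f I (-v)).ofLp) i / 2) ∈ A := fun I hI v hv => by
    have := hA (hf I v hI hv).1 (hA' _ (hf I (-v) hI hv.neg).1) (a := 1 / 2) (b := 1 / 2)
      (by norm_num) (by norm_num) (by norm_num)
    convert this using 1
    ext i
    simp
    ring
  -- Antisymmetrising a choice `f` to `(f v - f (-v)) / 2` makes it odd, and keeps it in `A` and
  -- near `v`.
  refine ⟨fun I v i => ((f I v).ofLp - (f I (-v)).ofLp) i / 2, fun I _ v _ => ?_, hmem,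
    fun I hI v hv j hj => ?_, hA2⟩
  · ext i
    simp
    ring
  -- The common index of `I` and `J` already contributes at least `1 - ε` to a sum bounded by `1 +
  -- t`.
  · obtain ⟨J, hJ, hjJ⟩ := hc.cover_right j (Finset.mem_univ j)
    obtain ⟨i, hi⟩ := hc.inter I hI J hJ
    obtain ⟨hiI, hiJ⟩ := Finset.mem_inter.1 (hi ▸ Finset.mem_singleton_self i)
    have h1 := hle _ (hA2 I hI v hv) J hJ
    have h2 := Finset.add_le_sum
      (f := fun j => |((f I v).ofLp - (f I (-v)).ofLp) j / 2|)
      (fun _ _ => abs_nonneg _) hiJ hjJ (fun h => hj (h ▸ hiI))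
    have h3 := hmem I hI v hv i hiI
    have h4 := (hv i).1 hiI
    have h5 := abs_sub_abs_le_abs_sub (v i) (((f I v).ofLp - (f I (-v)).ofLp) i / 2)
    rw [abs_sub_comm] at h3
    have h6 := h2.trans h1
    simp only at h6 ⊢
    linarith

end Polytope

/-! ### Closeness at vertices and polar vertices controls the Hausdorff distance. -/

section Stability

variable {n : ℕ} {𝓘 𝓙 : Set (Finset (Fin n))} {H K : Set (EuclideanSpace ℝ (Fin n))}

theorem exists_dist_le_of_near_vertices (hH : H = convexHull ℝ (signVecs 𝓘))
    (hK : Convex ℝ K) {r : ℝ}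
    (h : ∀ I ∈ 𝓘, ∀ v : EuclideanSpace ℝ (Fin n), IsSignVec I v.ofLp → ∃ p ∈ K, ‖p - v‖ ≤ r)
    {x : EuclideanSpace ℝ (Fin n)} (hx : x ∈ H) : ∃ y ∈ K, dist x y ≤ r := by
  have hsub : H ⊆ K + Metric.closedBall 0 r := by
    rw [hH]
    refine convexHull_min ?_ (hK.add (convex_closedBall 0 r))
    rintro v ⟨I, hI, hv⟩
    obtain ⟨p, hp, hpv⟩ := h I hI v hv
    exact ⟨p, hp, v - p, by simpa [norm_sub_rev] using hpv, by simp⟩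
  obtain ⟨y, hy, z, hz, rfl⟩ := hsub hx
  exact ⟨y, hy, by simpa [dist_eq_norm] using hz⟩

/-- Testing `x` against `q` instead of `w` shows that the facet inequalities hold up to `t = ‖x‖ *
r`; dividing by `1 + t` puts `x` in `H` and moves it by at most `t * ‖x‖`. -/
theorem exists_dist_le_of_near_polar_vertices
    (hH : ∀ x, x ∈ H ↔ ∀ J ∈ 𝓙, ∑ j ∈ J, |x j| ≤ 1) {r : ℝ} (hr : 0 ≤ r)
    (h : ∀ J ∈ 𝓙, ∀ w : EuclideanSpace ℝ (Fin n), IsSignVec J w.ofLp →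
      ∃ q ∈ polarSet K, ‖q - w‖ ≤ r)
    {x : EuclideanSpace ℝ (Fin n)} (hx : x ∈ K) : ∃ y ∈ H, dist x y ≤ ‖x‖ ^ 2 * r := by
  set t := ‖x‖ * r with ht
  have ht0 : 0 ≤ t := by positivity
  have hpos : 0 < 1 + t := by linarith
  have hsum : ∀ J ∈ 𝓙, ∑ j ∈ J, |x j| ≤ 1 + t := fun J hJ => by
    obtain ⟨w, hw, hxw⟩ := IsSignVec.exists_sum_mul_eq_sum_abs J x.ofLp
    obtain ⟨q, hq, hqw⟩ := h J hJ (WithLp.toLp 2 w) hw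
    have h1 : inner ℝ x (WithLp.toLp 2 w) = inner ℝ x q - inner ℝ x (q - WithLp.toLp 2 w) := by
      rw [← inner_sub_right]; simp
    have h2 := (abs_le.1 ((abs_real_inner_le_norm x (q - WithLp.toLp 2 w)).trans
      (mul_le_mul_of_nonneg_left hqw (norm_nonneg x)))).1
    have h3 := hq x hx
    rw [EuclideanSpace.inner_eq_sum_mul] at h1
    simp only at h1
    linarith
  refine ⟨(1 + t)⁻¹ • x, (hH _).2 fun J hJ => ?_, ?_⟩
  · simp only [PiLp.smul_apply, smul_eq_mul, abs_mul, ← Finset.mul_sum,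
      abs_of_pos (inv_pos.2 hpos)]
    rw [inv_mul_le_iff₀ hpos, mul_one]
    exact hsum J hJ
  · have e : x - (1 + t)⁻¹ • x = (t / (1 + t)) • x := by
      have h1 : t / (1 + t) = 1 - (1 + t)⁻¹ := by field_simp; ring
      rw [h1, sub_smul, one_smul]
    rw [dist_eq_norm, e, norm_smul, Real.norm_of_nonneg (by positivity)]
    have : t / (1 + t) ≤ t := div_le_self ht0 (by linarith)
    calc t / (1 + t) * ‖x‖ ≤ t * ‖x‖ := mul_le_mul_of_nonneg_right this (norm_nonneg x)
      _ = ‖x‖ ^ 2 * r := by rw [ht]; ring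

theorem norm_le_of_mem_iff (hc : CrossCovering Finset.univ 𝓘 𝓙)
    (hH : ∀ x, x ∈ H ↔ ∀ J ∈ 𝓙, ∑ j ∈ J, |x j| ≤ 1) :
    ∀ x ∈ H, ‖x‖ ≤ n := fun x hx => by
  rw [← mul_one (n : ℝ)]
  refine EuclideanSpace.norm_le_mul_of_abs_le fun i => ?_
  obtain ⟨J, hJ, hiJ⟩ := hc.cover_right i (Finset.mem_univ i)
  exact (Finset.single_le_sum (f := fun j => |x j|) (fun _ _ => abs_nonneg _) hiJ).trans
    ((hH x).1 hx J hJ)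

theorem sum_abs_le_of_near (hH : ∀ x, x ∈ H ↔ ∀ J ∈ 𝓙, ∑ j ∈ J, |x j| ≤ 1) {s : ℝ}
    {x : EuclideanSpace ℝ (Fin n)} (hx : ∃ h ∈ H, dist x h ≤ s) {J : Finset (Fin n)}
    (hJ : J ∈ 𝓙) : ∑ j ∈ J, |x j| ≤ 1 + n * s := by
  obtain ⟨h, hh, hs⟩ := hx
  have hs0 : 0 ≤ s := dist_nonneg.trans hs
  have h1 : ∀ j ∈ J, |x j| ≤ |h j| + s := fun j _ => by
    have h2 := (PiLp.norm_apply_le (x - h) j).trans (dist_eq_norm x h ▸ hs)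
    rw [PiLp.sub_apply, Real.norm_eq_abs] at h2
    linarith [abs_sub_abs_le_abs_sub (x j) (h j)]
  refine (Finset.sum_le_sum h1).trans ?_
  rw [Finset.sum_add_distrib, Finset.sum_const, nsmul_eq_mul]
  have hcard : (J.card : ℝ) ≤ n := by simpa using (Nat.cast_le (α := ℝ)).2 (Finset.card_le_univ J)
  exact add_le_add ((hH h).1 hh J hJ) (mul_le_mul_of_nonneg_right hcard hs0)

theorem norm_le_and_sum_abs_le_of_mem_polarSet (hc : CrossCovering Finset.univ 𝓘 𝓙)
    {s : ℝ} (hs : 0 ≤ s) (hns : n * s ≤ 1 / 2)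
    (h : ∀ I ∈ 𝓘, ∀ v : EuclideanSpace ℝ (Fin n), IsSignVec I v.ofLp → ∃ p ∈ K, dist v p ≤ s)
    {y : EuclideanSpace ℝ (Fin n)} (hy : y ∈ polarSet K) :
    ‖y‖ ≤ 2 * n ∧ ∀ I ∈ 𝓘, ∑ i ∈ I, |y i| ≤ 1 + 2 * n * s := by
  have h1 : ∀ I ∈ 𝓘, ∑ i ∈ I, |y i| ≤ 1 + ‖y‖ * s := fun I hI => by
    obtain ⟨v, hv, hyv⟩ := IsSignVec.exists_sum_mul_eq_sum_abs I y.ofLp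
    obtain ⟨p, hp, hpv⟩ := h I hI (WithLp.toLp 2 v) hv
    have e : inner ℝ y (WithLp.toLp 2 v) = inner ℝ y p + inner ℝ y (WithLp.toLp 2 v - p) := by
      rw [← inner_add_right]; simp
    have h2 := (real_inner_le_norm y (WithLp.toLp 2 v - p)).trans
      (mul_le_mul_of_nonneg_left (dist_eq_norm (WithLp.toLp 2 v) p ▸ hpv) (norm_nonneg y))
    have h3 := hy p hp
    rw [real_inner_comm] at h3
    rw [EuclideanSpace.inner_eq_sum_mul] at e
    simp only at e
    linarith
  -- A self-bounding estimate: `n * s ≤ 1 / 2` absorbs the right-hand `‖y‖`.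
  have h2 : ‖y‖ ≤ n * (1 + ‖y‖ * s) := EuclideanSpace.norm_le_mul_of_abs_le fun i => by
    obtain ⟨I, hI, hiI⟩ := hc.cover_left i (Finset.mem_univ i)
    exact (Finset.single_le_sum (f := fun j => |y j|) (fun _ _ => abs_nonneg _) hiI).trans
      (h1 I hI)
  have h3 : ‖y‖ ≤ 2 * n := by
    have := mul_le_mul_of_nonneg_left hns (norm_nonneg y)
    linarith
  exact ⟨h3, fun I hI => (h1 I hI).trans (by gcongr)⟩

theorem norm_toLp_sub_le {I : Finset (Fin n)} {p v : Fin n → ℝ} (hv : IsSignVec I v) {ρ : ℝ}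
    (hI : ∀ i ∈ I, |p i - v i| ≤ ρ) (hI' : ∀ i ∉ I, |p i| ≤ ρ) :
    ‖WithLp.toLp 2 p - WithLp.toLp 2 v‖ ≤ n * ρ := by
  refine EuclideanSpace.norm_le_mul_of_abs_le fun i => ?_
  by_cases hi : i ∈ I
  · simpa using hI i hi
  · simpa [(hv i).2 hi] using hI' i hi

/-- If the relevant projections of `K` and of its polar are `ε`-close to cubes, then `K` is close
to `H` up to `ε` and a quadratic error. -/
theorem hausdorffDist_le_of_projSupport (hc : CrossCovering Finset.univ 𝓘 𝓙)
    (hH : H = convexHull ℝ (signVecs 𝓘)) (hH' : ∀ x, x ∈ H ↔ ∀ J ∈ 𝓙, ∑ j ∈ J, |x j| ≤ 1)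
    (hK : IsSymmConvexBody K) {δ ε : ℝ} (hKH : Metric.hausdorffDist K H = δ) (hδ : 0 < δ)
    (hε : 0 ≤ ε) (hεδ : ε ≤ δ) (hδn : 5 * n * δ ≤ 1)
    (hv : ∀ v, IsVertex H v → Metric.hausdorffDist (projSupport K v) (supportCube v) < ε)
    (hw : ∀ w, IsVertex (polarSet H) w →
      Metric.hausdorffDist (projSupport (polarSet K) w) (supportCube w) < ε) :
    δ ≤ (n + 1) ^ 2 * (n * (18 * n ^ 2 * (ε + (5 * n * δ) ^ 2))) := by
  obtain ⟨I₀, hI₀⟩ := hc.nonempty_left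
  obtain ⟨J₀, hJ₀⟩ := hc.nonempty_right
  obtain ⟨i₀, -⟩ := hc.inter I₀ hI₀ J₀ hJ₀
  have hn : (1 : ℝ) ≤ n := by exact_mod_cast (Nat.zero_le _).trans_lt i₀.isLt
  have hKne : K.Nonempty := hK.interior_nonempty.mono interior_subset
  have hKneg : ∀ x ∈ K, -x ∈ K := fun x hx => by
    rw [← hK.neg_eq]; simpa using hx
  have hHn := norm_le_of_mem_iff hc hH'
  have hHb : Bornology.IsBounded H :=
    (Metric.isBounded_closedBall (x := 0) (r := n)).subset fun x hx => by simpa using hHn x hx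
  have hHne : H.Nonempty := ⟨0, hH ▸ zero_mem_convexHull_signVecs hc.nonempty_left⟩
  have hfin := Metric.hausdorffEDist_ne_top_of_nonempty_of_bounded hKne hHne
    hK.isCompact.isBounded hHb
  -- The factor `2` gives a strict inequality, so that nearby points can be extracted.
  have hlt : Metric.hausdorffDist K H < 2 * δ := by linarith
  have hKnear : ∀ x ∈ K, ∃ h ∈ H, dist x h ≤ 2 * δ := fun x hx => by
    obtain ⟨h, hh, hd⟩ := Metric.exists_dist_lt_of_hausdorffDist_lt hx hlt hfin
    exact ⟨h, hh, hd.le⟩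
  have hHnear : ∀ I ∈ 𝓘, ∀ v : EuclideanSpace ℝ (Fin n), IsSignVec I v.ofLp →
      ∃ p ∈ K, dist v p ≤ 2 * δ := fun I hI v hv => by
    obtain ⟨h, hh, hd⟩ := Metric.exists_dist_lt_of_hausdorffDist_lt'
      (hH ▸ subset_convexHull ℝ _ ⟨I, hI, hv⟩ : v ∈ H) hlt hfin
    exact ⟨h, hh, (dist_comm v h ▸ hd).le⟩
  have hnδ : δ ≤ n * δ := le_mul_of_one_le_left hδ.le hn
  have hpolar := fun y hy => norm_le_and_sum_abs_le_of_mem_polarSet (K := K) (y := y) hc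
    (by linarith : 0 ≤ 2 * δ) (by linarith) hHnear hy
  have hpolarb : Bornology.IsBounded (polarSet K) :=
    (Metric.isBounded_closedBall (x := 0) (r := 2 * n)).subset fun x hx => by
      simpa using (hpolar x hx).1
  have hH_polar := fun y => mem_polarSet_convexHull_signVecs_iff (𝓘 := 𝓘) y
  rw [← hH] at hH_polar
  -- The slack `4 * n * δ` serves both bodies: `K` needs `n * (2 * δ)`, its polar `2 * n * (2 * δ)`.
  -- Adding `ε ≤ n * δ` gives the crude off-support bound `5 * n * δ`.
  obtain ⟨p, hp_neg, hp_mem, hp_notMem, hpK⟩ := hc.exists_odd_selection hK.convex hKneg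
    (ε := ε) (t := 4 * n * δ)
    (fun x hx J hJ => (sum_abs_le_of_near hH' (hKnear x hx) hJ).trans (by linarith))
    fun I hI v hvI => exists_near_of_hausdorffDist_lt hK.isCompact.isBounded hKne hvI
      (hv v (hc.isVertex hH' hI hvI))
  obtain ⟨q, hq_neg, hq_mem, hq_notMem, hqK⟩ := hc.symm.exists_odd_selection
    (convex_polarSet K) (fun y hy => polarSet_neg_mem hK.neg_eq hy) (ε := ε) (t := 4 * n * δ)
    (fun x hx J hJ => ((hpolar x hx).2 J hJ).trans (by linarith))
    fun J hJ w hwJ => exists_near_of_hausdorffDist_lt hpolarb ⟨0, zero_mem_polarSet K⟩ hwJ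
      (hw w (hc.symm.isVertex hH_polar hJ hwJ))
  have hD : 4 * n * δ + ε ≤ 5 * n * δ := by linarith
  have hD0 : 0 ≤ 5 * n * δ := by positivity
  have hpq : ∀ I ∈ 𝓘, ∀ J ∈ 𝓙, ∀ v w, IsSignVec I v → IsSignVec J w → p I v ⬝ᵥ q J w ≤ 1 :=
    fun I hI J hJ v w hv hw => by
      have := hqK J hJ w hw _ (hpK I hI v hv)
      rwa [EuclideanSpace.inner_eq_sum_mul] at this
  have hε1 : ε ≤ 1 := by linarith
  have hp_off := fun I hI v hv j hj => abs_apply_le_of_pairing_le_one hc hε hε1 hD0 hδn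
    hp_neg hp_mem (fun I hI v hv i hi => (hp_notMem I hI v hv i hi).trans hD)
    hq_neg hq_mem (fun I hI v hv i hi => (hq_notMem I hI v hv i hi).trans hD) hpq
    (I := I) hI (v := v) hv (j := j) hj
  have hq_off := fun I hI v hv j hj => abs_apply_le_of_pairing_le_one hc.symm hε hε1 hD0 hδn
    hq_neg hq_mem (fun I hI v hv i hi => (hq_notMem I hI v hv i hi).trans hD)
    hp_neg hp_mem (fun I hI v hv i hi => (hp_notMem I hI v hv i hi).trans hD)
    (fun J hJ I hI w v hw hv => dotProduct_comm (p I v) (q J w) ▸ hpq I hI J hJ v w hv hw)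
    (I := I) hI (v := v) hv (j := j) hj
  rw [Fintype.card_fin] at hp_off hq_off
  set ρ := 18 * (n : ℝ) ^ 2 * (ε + (5 * n * δ) ^ 2) with hρ
  have hρ0 : 0 ≤ ρ := by positivity
  have hερ : ε ≤ ρ := by
    have h1 : (1 : ℝ) ≤ 18 * (n : ℝ) ^ 2 := by nlinarith
    have h2 : 0 ≤ (5 * n * δ) ^ 2 := by positivity
    calc ε ≤ 1 * (ε + (5 * n * δ) ^ 2) := by linarith
      _ ≤ ρ := mul_le_mul_of_nonneg_right h1 (by linarith)
  have hnρ : 0 ≤ n * ρ := by positivity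
  rw [← hKH]
  refine Metric.hausdorffDist_le_of_mem_dist (by positivity) (fun x hx => ?_) fun x hx => ?_
  · obtain ⟨y, hy, hxy⟩ := exists_dist_le_of_near_polar_vertices hH' hnρ
      (fun J hJ w hw => ⟨_, hqK J hJ w.ofLp hw, norm_toLp_sub_le hw
        (fun i hi => (hq_mem J hJ _ hw i hi).trans hερ) (hq_off J hJ _ hw)⟩) hx
    refine ⟨y, hy, hxy.trans (mul_le_mul_of_nonneg_right ?_ hnρ)⟩
    obtain ⟨h, hh, hd⟩ := hKnear x hx
    have h1 := norm_le_norm_add_norm_sub h x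
    rw [norm_sub_rev, ← dist_eq_norm] at h1
    have h2 := hHn h hh
    gcongr
    linarith
  · obtain ⟨y, hy, hxy⟩ := exists_dist_le_of_near_vertices hH hK.convex
      (fun I hI v hv => ⟨_, hpK I hI v.ofLp hv, norm_toLp_sub_le hv
        (fun i hi => (hp_mem I hI _ hv i hi).trans hερ) (hp_off I hI _ hv)⟩) hx
    refine ⟨y, hy, hxy.trans (le_mul_of_one_le_left hnρ ?_)⟩
    nlinarith

end Stability

/-! ### Choice of the constants. -/

theorem mainTheorem5 (n : ℕ) :
    ∃ c : ℝ, 0 < c ∧ ∃ δ₀ : ℝ, 0 < δ₀ ∧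
      ∀ H K : Set (EuclideanSpace ℝ (Fin n)),
        IsStandardHanner H → IsSymmConvexBody K →
        ∀ δ : ℝ, Metric.hausdorffDist K H = δ → 0 < δ → δ < δ₀ →
          (∃ v, IsVertex H v ∧
            c * δ ≤ Metric.hausdorffDist (projSupport K v) (supportCube v)) ∨
          (∃ w, IsVertex (polarSet H) w ∧
            c * δ ≤ Metric.hausdorffDist (projSupport (polarSet K) w) (supportCube w)) := by
  set M : ℝ := (n + 1) ^ 2 * (n * (18 * n ^ 2)) + 1 with hM
  have hM1 : 1 ≤ M := by
    have : (0 : ℝ) ≤ (n + 1) ^ 2 * (n * (18 * n ^ 2)) := by positivity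
    linarith
  have hM0 : 0 < M := by linarith
  -- With these choices the linear term `M * c * δ` equals `δ / 4` and the quadratic term `M * (5 *
  -- n * δ) ^ 2` is at most `δ / 4`, so `δ ≤ δ / 2`, a contradiction.
  refine ⟨1 / (4 * M), by positivity, 1 / (100 * M * (n + 1) ^ 2), by positivity, ?_⟩
  intro H K hH hK δ hKH hδ hδ₀
  by_contra! hcon
  obtain ⟨𝓘, 𝓙, hc, hHull, hmem⟩ := StdHannerOn.exists_crossCovering hH
  have hH' := hc.mem_iff hHull fun x hx => hmem x (fun i hi => absurd (Finset.mem_univ i) hi) hx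
  have hδ₁ : δ * (100 * M * (n + 1) ^ 2) < 1 := (lt_div_iff₀ (by positivity)).1 hδ₀
  have hn0 : (0 : ℝ) ≤ n := Nat.cast_nonneg n
  have hcM : M * (1 / (4 * M) * δ) = δ / 4 := by field_simp
  have hsq : δ * (100 * M * (n : ℝ) ^ 2) ≤ 1 := by
    refine le_trans ?_ hδ₁.le
    gcongr
    linarith
  have hδn : 5 * n * δ ≤ 1 := by
    refine le_trans ?_ hδ₁.le
    have h1 : 5 * (n : ℝ) ≤ 100 * 1 * (n + 1) ^ 2 := by nlinarith
    have h2 : 100 * 1 * ((n : ℝ) + 1) ^ 2 ≤ 100 * M * (n + 1) ^ 2 := by gcongr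
    nlinarith
  have hcδ : 1 / (4 * M) * δ ≤ δ := by
    refine mul_le_of_le_one_left hδ.le ?_
    rw [div_le_one (by positivity)]
    linarith
  have key := hausdorffDist_le_of_projSupport hc hHull hH' hK hKH hδ (by positivity) hcδ hδn
    hcon.1 hcon.2
  have hquad : M * (5 * n * δ) ^ 2 ≤ δ / 4 := by
    have : M * (5 * n * δ) ^ 2 = δ * (100 * M * (n : ℝ) ^ 2) * (δ / 4) := by ring
    rw [this]
    exact mul_le_of_le_one_left (by linarith) hsq
  have hle : (n + 1) ^ 2 * (n * (18 * n ^ 2 * (1 / (4 * M) * δ + (5 * n * δ) ^ 2))) ≤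
      M * (1 / (4 * M) * δ + (5 * n * δ) ^ 2) := by
    have h0 : 0 ≤ 1 / (4 * M) * δ + (5 * n * δ) ^ 2 := by positivity
    have e : (n + 1) ^ 2 * (n * (18 * n ^ 2 * (1 / (4 * M) * δ + (5 * n * δ) ^ 2))) =
      (M - 1) * (1 / (4 * M) * δ + (5 * n * δ) ^ 2) := by rw [hM]; ring
    rw [e]
    gcongr
    linarith
  have h := key.trans hle
  rw [mul_add, hcM] at h
  linarith
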